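/- Let $\mathtt a(t)=\mathrm{diag}(e^{t/2},e^{-t/2})$ and $\mathtt u(s)=\begin{pmatrix}1&s\\0&1\end{pmatrix}$ for $t,s\in\mathbb R$, and let $B\cong\mathbb R\ltimes\mathbb R$ be the subgroup of $\mathrm{SL}_2(\mathbb R)$ generated by all $\mathtt a(t)$ and $\mathtt u(s)$. Let $X$ be a locally compact second countable Hausdorff space with its Borel $\sigma$-algebra, on which $B$ acts continuously. Leafwise measures. Let $\mu$ be a probability measure on $X$ that is $\mathtt u$-free, i.e. for $\mu$-almost every $x$ the only $s\in\mathbb R$ with $\mathtt u(s)x=x$ is $s=0$. Let $\omega$ be the image of $\mu\times m_{\mathbb R}$ (with $m_{\mathbb R}$ the Lebesgue measure) under $(x,s)\mapsto(\mathtt u(-s)x,s)$, and for a nonnegative Borel function $f$ on $\mathbb R$ with $\int_{\mathbb R} f(s)\,ds=1$ let $S_f\mu=\int_{\mathbb R} f(s)\,\mathtt u(-s)_*\mu\,ds$. The $\mathtt u$-leafwise measures of $\mu$ are a measurable family $(\mu^{\mathtt u}_y)_{y\in X}$ of locally finite measures on $\mathbb R$ such that 1. for all $s\in\mathbb R$ and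 $y\in X$, the measure $\mu^{\mathtt u}_{\mathtt u(s)y}$ equals, up to a positive factor, the image of $\mu^{\mathtt u}_y$ under $r\mapsto r-s$; 2. for every such $f$, one has $0<\mu^{\mathtt u}_y(f):=\int f\,d\mu^{\mathtt u}_y<\infty$ for $S_f\mu$-almost every $y$, and $$\tilde f\cdot\omega=\int_X\delta_y\times\frac{f\cdot\mu^{\mathtt u}_y}{\mu^{\mathtt u}_y(f)}\,dS_f\mu(y),\qquad \tilde f(x,s)=f(s).$$ Such a family exists, and it is unique up to positive factors for $\mu$-almost every $y$. An $\mathtt a$-invariant $\mathtt u$-free probability measure $\mu$ has $\mathtt u$-leafwise dimension $\dim^{\mathtt u}(\mu)=\delta$ if for $\mu$-almost every $x$ $$\lim_{t\to\infty}\frac1t\log\mu^{\mathtt u}_x([-e^{-t},e^{-t}])=-\delta .$$ Theorem. Let $(\mu_k)_{k\ge1}$ be Borel probability measures on $X$, each of which is $\mathtt a$-invariant, ergodic for the flow $(\mathtt a(t))_{t\in\mathbb R}$, and $\mathtt u$-free. Suppose that their $\mathtt u$-leafwise dimensions satisfy $\dim^{\mathtt u}(\mu_k)\to1$ as $k\to\infty$,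 and that $\mu_k$ converges weak-$*$ to a probability measure $\mu_\infty$ on $X$, that is, $\int f\,d\mu_k\to\int f\,d\mu_\infty$ for every continuous $f:X\to\mathbb R$ with compact support. Then $\mu_\infty$ is $\mathtt u$-invariant. -/

import Mathlib

open MeasureTheory Filter Topology Matrix
open scoped NNReal ENNReal

namespace LeafwiseDim

noncomputable section

/-- The matrix `diag(e^{t/2}, e^{-t/2})` of `SL₂(ℝ)`. -/
def aMat (t : ℝ) : Matrix.SpecialLinearGroup (Fin 2) ℝ :=
  ⟨!![Real.exp (t / 2), 0; 0, Real.exp (-(t / 2))], by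
    simp [Matrix.det_fin_two_of, ← Real.exp_add]⟩

/-- The unipotent upper triangular matrix of `SL₂(ℝ)` with upper right entry `s`. -/
def uMat (s : ℝ) : Matrix.SpecialLinearGroup (Fin 2) ℝ :=
  ⟨!![1, s; 0, 1], by simp [Matrix.det_fin_two_of]⟩

/-- The group `B ≅ ℝ ⋉ ℝ` (with the exponential action): the subgroup of `SL₂(ℝ)` generated by
all `aMat t` and all `uMat s`. It carries the topology induced from `SL₂(ℝ)`. -/
abbrev B : Subgroup (Matrix.SpecialLinearGroup (Fin 2) ℝ) :=
  Subgroup.closure (Set.range aMat ∪ Set.range uMat)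

/-- The one-parameter subgroup `a` of `B`. -/
def a (t : ℝ) : B :=
  ⟨aMat t, Subgroup.subset_closure (Or.inl ⟨t, rfl⟩)⟩

/-- The one-parameter subgroup `u` of `B`. -/
def u (s : ℝ) : B :=
  ⟨uMat s, Subgroup.subset_closure (Or.inr ⟨s, rfl⟩)⟩

section Leafwise

variable {X : Type*} [MeasurableSpace X]

/-- The anti-convolution `S_f μ = ∫ f(s) (u(-s)_* μ) ds`, written as the image of
`μ × (f · Lebesgue)` under `(x, s) ↦ u(-s) x`, for a flow `φ s x = u(s) x`. -/
def antiConv (φ : ℝ → X → X) (f : ℝ → ℝ≥0) (μ : Measure X) : Measure X :=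
  (μ.prod (volume.withDensity fun s => (f s : ℝ≥0∞))).map fun p => φ (-p.2) p.1

/-- The measure `ω = F_*(μ × Lebesgue)` on `X × ℝ`, where `F (x, s) = (u(-s) x, s)`. -/
def skewMeasure (φ : ℝ → X → X) (μ : Measure X) : Measure (X × ℝ) :=
  (μ.prod volume).map fun p => (φ (-p.2) p.1, p.2)

/-- `ν` is a family of leafwise measures of `μ` along the flow `φ`. -/
structure IsLeafwiseFamily (φ : ℝ → X → X) (μ : Measure X) (ν : X → Measure ℝ) : Prop where
  measurable : Measurable ν
  locallyFinite : ∀ y, IsLocallyFiniteMeasure (ν y)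
  /-- `ν_{u(s) y}` is proportional to the translate of `ν_y` by `-s`. -/
  translate : ∀ (s : ℝ) (y : X), ∃ c : ℝ≥0, 0 < c ∧
    ν (φ s y) = c • (ν y).map fun r => r - s
  /-- `0 < ν_y(f) < ∞` for almost every `y`. -/
  pos_finite : ∀ f : ℝ → ℝ≥0, Measurable f → ∫⁻ s, (f s : ℝ≥0∞) = 1 →
    ∀ᵐ y ∂(antiConv φ f μ), 0 < ∫⁻ s, (f s : ℝ≥0∞) ∂(ν y) ∧ ∫⁻ s, (f s : ℝ≥0∞) ∂(ν y) < ∞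
  /-- `f · ω = ∫ δ_y × (f · ν_y / ν_y(f)) d(S_f μ)(y)`, an equality of measures on `X × ℝ`,
  expressed by integrating nonnegative measurable functions `g` against both sides. -/
  disintegration : ∀ f : ℝ → ℝ≥0, Measurable f → ∫⁻ s, (f s : ℝ≥0∞) = 1 →
    ∀ g : X × ℝ → ℝ≥0∞, Measurable g →
      ∫⁻ p, (f p.2 : ℝ≥0∞) * g p ∂(skewMeasure φ μ) =
        ∫⁻ y, (∫⁻ s, (f s : ℝ≥0∞) * g (y, s) ∂(ν y)) / (∫⁻ s, (f s : ℝ≥0∞) ∂(ν y))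
          ∂(antiConv φ f μ)

variable [MulAction B X]

/-- Invariance of `μ` under all `a t`. -/
def IsAInvariant (μ : Measure X) : Prop :=
  ∀ t : ℝ, μ.map (fun x => a t • x) = μ

/-- Ergodicity of `μ` for the flow `(a t)`. -/
def IsAErgodic (μ : Measure X) : Prop :=
  ∀ E : Set X, MeasurableSet E → (∀ t : ℝ, (fun x => a t • x) ⁻¹' E = E) → μ E = 0 ∨ μ Eᶜ = 0

/-- Invariance of `μ` under all `u s`. -/
def IsUInvariant (μ : Measure X) : Prop :=
  ∀ s : ℝ, μ.map (fun x => u s • x) = μ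

/-- Almost every point has trivial stabilizer in `{u s}`. -/
def IsUFree (μ : Measure X) : Prop :=
  ∀ᵐ x ∂μ, ∀ s : ℝ, u s • x = x → s = 0

/-- `μ` has `u`-leafwise dimension `δ`: its leafwise measures `ν_x` along the flow `u` satisfy
`(1/t) log ν_x([-e^{-t}, e^{-t}]) → -δ` as `t → ∞`, for almost every `x`. (A family of leafwise
measures exists and is almost surely unique up to proportionality.) -/
def HasLeafwiseDim (μ : Measure X) (δ : ℝ) : Prop :=
  ∃ ν : X → Measure ℝ, IsLeafwiseFamily (fun s x => u s • x) μ ν ∧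
    ∀ᵐ x ∂μ, Tendsto
      (fun t : ℝ => 1 / t * Real.log ((ν x).real (Set.Icc (-Real.exp (-t)) (Real.exp (-t)))))
      atTop (𝓝 (-δ))

end Leafwise

/-- Weak-* convergence, i.e. convergence of the integrals of all continuous functions with compact
support. -/
def WeakStarTendsto {X : Type*} [TopologicalSpace X] [MeasurableSpace X]
    (μ : ℕ → Measure X) (μ' : Measure X) : Prop :=
  ∀ f : X → ℝ, Continuous f → HasCompactSupport f →
    Tendsto (fun k => ∫ x, f x ∂(μ k)) atTop (𝓝 (∫ x, f x ∂μ'))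

end

end LeafwiseDim

namespace LeafwiseDim

noncomputable section

/-! ### Elementary inequalities for finite entropy -/

section FiniteEntropy

open Finset Real

/-! Leafwise dimension near 1 forces the leafwise measures to be almost uniform at most scales, and
`a` transports this to every fixed scale. Normalise the leafwise measure at `y` on `[0,1)` to a
probability `κ y`. Then `μ` is a mixture of the images of `κ y` under `s ↦ u s • y`
(`exists_unit_kernel`, `map_jointLaw`). Since `a t` preserves `μ` and expands `u`-orbits by `exp t`,
the defect `∫ g dμ - ∫ g (u s₀ • x) dμ` can be computed at any magnification `n ^ i`. There it
measures how unevenly `κ y` distributes the mass of `n`-adic cells of level `i` among their `n`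
children, which a weak Pinsker inequality bounds linearly by `log n` minus the entropy gained from
level `i` to `i + 1` (`abs_integral_sub_shift_le`). The defect does not depend on `i`, so averaging
over `i < N` telescopes the gains into the mean entropy at level `N`. By the local dimension and
Fatou's lemma this is at least `N * b` for some `N > 0`, for any prescribed nonnegative `b < δ log
n` (`exists_le_integral_cellEntropy`). The resulting bound (`abs_integral_sub_integral_u_smul_le`)
involves `μ` only through `δ`, while `n` depends only on `g`, `s₀` and the tolerance; hence it
passes to the limit as `δ → 1`. -/

lemma sum_range_mul_eq_sum_sum (a n : ℕ) (F : ℕ → ℝ) :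
    ∑ J ∈ range (a * n), F J = ∑ j ∈ range a, ∑ l ∈ range n, F (j * n + l) := by
  induction a with
  | zero => simp
  | succ a ih => rw [add_mul, one_mul, sum_range_add, ih, sum_range_succ]

/-- Factor `x - 1 = (√x + 1)(√x - 1)`; the bound `log √x ≥ 1 - 1/√x` gives `(√x - 1)² ≤ x log x - x
+ 1`. -/
lemma sub_one_sq_le {x b : ℝ} (hx : 0 ≤ x) (hxb : x ≤ b) :
    (x - 1) ^ 2 ≤ 2 * (b + 1) * (x * log x - x + 1) := by
  have hs : 0 ≤ √x := sqrt_nonneg x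
  have hsq : √x * √x = x := mul_self_sqrt hx
  have key : (√x - 1) ^ 2 ≤ x * log x - x + 1 := by
    rcases hx.eq_or_lt with rfl | hx'
    · simp
    · have hs' : 0 < √x := sqrt_pos.2 hx'
      have h1 : 1 - (√x)⁻¹ ≤ log √x := one_sub_inv_le_log_of_pos hs'
      have h2 : log x = 2 * log √x := by rw [log_sqrt hx]; ring
      have h3 : x * (√x)⁻¹ = √x := by
        rw [← div_eq_mul_inv, div_sqrt]
      nlinarith [mul_le_mul_of_nonneg_left h1 hx]
  have h4 : (x - 1) ^ 2 = (√x + 1) ^ 2 * (√x - 1) ^ 2 := by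
    nth_rw 1 [← hsq]; ring
  have h5 : (√x + 1) ^ 2 ≤ 2 * (b + 1) := by nlinarith [sq_nonneg (√x - 1)]
  rw [h4]
  exact mul_le_mul h5 key (sq_nonneg _) (by nlinarith)

/-- AM-GM with a free parameter `η` replaces the square root of Pinsker's inequality by a bound
affine in the entropy term, so that it can be summed over cells, integrated and telescoped. -/
lemma abs_sub_one_le {x b η : ℝ} (hx : 0 ≤ x) (hxb : x ≤ b) (hη : 0 < η) :
    |x - 1| ≤ η + (b + 1) / (2 * η) * (x * log x - x + 1) := by
  have h1 := sub_one_sq_le hx hxb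
  have h2 : |x - 1| * (4 * η) ≤ 4 * η ^ 2 + (x - 1) ^ 2 := by
    rw [← sq_abs (x - 1)]
    nlinarith [sq_nonneg (|x - 1| - 2 * η)]
  have h3 : (η + (b + 1) / (2 * η) * (x * log x - x + 1)) * (4 * η)
      = 4 * η ^ 2 + 2 * (b + 1) * (x * log x - x + 1) := by
    field_simp; ring
  refine le_of_mul_le_mul_right ?_ (by positivity : 0 < 4 * η)
  rw [h3]; linarith

/-- A weak form of Pinsker's inequality for a finite vector of masses `w` of total mass `W`. -/
lemma sum_abs_sub_average_le {n : ℕ} (hn : 0 < n) {w : ℕ → ℝ} (hw : ∀ l, 0 ≤ w l)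
    {W : ℝ} (hW : ∑ l ∈ range n, w l = W) {η : ℝ} (hη : 0 < η) :
    ∑ l ∈ range n, |w l - W / n| ≤ η * W + (n + 1) / (2 * η) *
      (W * log n - (∑ l ∈ range n, negMulLog (w l) - negMulLog W)) := by
  have hn' : (0 : ℝ) < n := by exact_mod_cast hn
  have hle : ∀ l ∈ range n, w l ≤ W := fun l hl => by
    rw [← hW]; exact single_le_sum (fun i _ => hw i) hl
  have hW0 : 0 ≤ W := by rw [← hW]; exact sum_nonneg fun i _ => hw i
  rcases hW0.eq_or_lt with h0 | hWpos
  · have hz : ∀ l ∈ range n, w l = 0 := fun l hl =>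
      le_antisymm (h0 ▸ hle l hl) (hw l)
    have h1 : ∑ l ∈ range n, |w l - W / n| = 0 :=
      sum_eq_zero fun l hl => by rw [hz l hl, ← h0]; simp
    have h2 : ∑ l ∈ range n, negMulLog (w l) = 0 :=
      sum_eq_zero fun l hl => by rw [hz l hl, negMulLog_zero]
    rw [h1, h2, ← h0]
    simp
  -- Apply the scalar bound to the density `n * w l / W` relative to the uniform distribution; it is
  -- at most `n`, whence the constant `n + 1`.
  · have hterm : ∀ l ∈ range n, |w l - W / n| ≤ (W / n) * η + (n + 1) / (2 * η) *
        (w l * log n - negMulLog (w l) - w l * log W - w l + W / n) := by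
      intro l hl
      have hx0 : 0 ≤ n * w l / W := by have := hw l; positivity
      have hxn : n * w l / W ≤ n := by
        rw [div_le_iff₀ hWpos]
        exact mul_le_mul_of_nonneg_left (hle l hl) hn'.le
      have h1 := mul_le_mul_of_nonneg_left (abs_sub_one_le hx0 hxn hη) (by positivity : 0 ≤ W / n)
      have h2 : W / n * |n * w l / W - 1| = |w l - W / n| := by
        rw [← abs_of_pos (by positivity : 0 < W / n), ← abs_mul,
          abs_of_pos (by positivity : 0 < W / n)]
        congr 1; field_simp
      have h3 : W / n * (n * w l / W * log (n * w l / W)) =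
          w l * log n - negMulLog (w l) - w l * log W := by
        rcases (hw l).eq_or_lt with h | h
        · simp [← h]
        · rw [log_div (by positivity) hWpos.ne', log_mul hn'.ne' h.ne', negMulLog]
          field_simp; ring
      have h4 : W / n * (n * w l / W) = w l := by field_simp
      rw [h2] at h1
      refine h1.trans_eq ?_
      linear_combination (n + 1) / (2 * η) * (h3 - h4)
    refine (sum_le_sum hterm).trans_eq ?_
    rw [sum_add_distrib, ← mul_sum _ _ (((n : ℝ) + 1) / (2 * η)), sum_add_distrib,
      sum_sub_distrib, sum_sub_distrib, sum_sub_distrib, ← sum_mul, ← sum_mul, ← sum_mul, hW, sum_const, card_range,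
      nsmul_eq_mul, negMulLog]
    field_simp
    ring

/-- The overlap of the two windows cancels, leaving `L` differences of boundary terms. -/
lemma abs_sum_sub_shift_le {κ : ℕ → ℝ} {M : ℝ} (hκ : ∀ l, |κ l| ≤ M) (n L : ℕ) :
    |∑ l ∈ range n, (κ l - κ (l + L))| ≤ 2 * M * L := by
  have h : ∑ l ∈ range n, (κ l - κ (l + L)) =
      ∑ l ∈ range L, (κ l - κ (n + l)) := by
    have h1 := sum_range_add κ n L
    have h2 := sum_range_add κ L n
    rw [add_comm L n] at h2
    simp only [sum_sub_distrib]
    simp only [add_comm L] at h2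
    linarith
  rw [h]
  refine (abs_sum_le_sum_abs _ _).trans ?_
  refine (sum_le_sum (g := fun _ => 2 * M) fun l _ => ?_).trans_eq ?_
  · have := abs_sub (κ l) (κ (n + l))
    linarith [hκ l, hκ (n + l)]
  · simp [mul_comm]

end FiniteEntropy

/-! ### Entropy of `n`-adic partitions and almost invariance under shifts -/

section Cells

open Finset Real

/-- The `J`-th `n`-adic interval of level `i`. -/
def cell (n i J : ℕ) : Set ℝ := Set.Ico (J / (n : ℝ) ^ i) ((J + 1) / (n : ℝ) ^ i)

lemma measurableSet_cell (n i J : ℕ) : MeasurableSet (cell n i J) := measurableSet_Ico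

lemma mem_cell {n i J : ℕ} (hn : 0 < n) {s : ℝ} :
    s ∈ cell n i J ↔ (J : ℝ) ≤ (n : ℝ) ^ i * s ∧ (n : ℝ) ^ i * s < J + 1 := by
  have h : (0 : ℝ) < (n : ℝ) ^ i := by positivity
  rw [cell, Set.mem_Ico, div_le_iff₀ h, lt_div_iff₀ h, mul_comm]

lemma eq_of_mem_cell {n i J K : ℕ} (hn : 0 < n) {s : ℝ} (hJ : s ∈ cell n i J)
    (hK : s ∈ cell n i K) : J = K := by
  rw [mem_cell hn] at hJ hK
  have h1 : (J : ℝ) < K + 1 := by linarith [hJ.1, hK.2]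
  have h2 : (K : ℝ) < J + 1 := by linarith [hK.1, hJ.2]
  have h3 : J < K + 1 := by exact_mod_cast h1
  have h4 : K < J + 1 := by exact_mod_cast h2
  omega

lemma exists_mem_cell {n : ℕ} (i : ℕ) (hn : 0 < n) {s : ℝ} (hs : s ∈ Set.Ico (0 : ℝ) 1) :
    ∃ J ∈ range (n ^ i), s ∈ cell n i J := by
  have h : (0 : ℝ) < (n : ℝ) ^ i := by positivity
  have h0 : 0 ≤ (n : ℝ) ^ i * s := mul_nonneg h.le hs.1
  refine ⟨⌊(n : ℝ) ^ i * s⌋₊, ?_, ?_⟩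
  · rw [mem_range, Nat.floor_lt h0]
    push_cast
    nlinarith [hs.2]
  · exact (mem_cell hn).2 ⟨Nat.floor_le h0, Nat.lt_floor_add_one _⟩

lemma sum_indicator_cell {R : Type*} [AddCommMonoid R] {n i J : ℕ} (hn : 0 < n)
    (hJ : J ∈ range (n ^ i)) {s : ℝ} (hs : s ∈ cell n i J) (c : ℕ → R) :
    ∑ K ∈ range (n ^ i), (cell n i K).indicator (fun _ => c K) s = c J := by
  rw [sum_eq_single_of_mem J hJ, Set.indicator_of_mem hs]
  intro K _ hK
  exact Set.indicator_of_notMem (fun h => hK (eq_of_mem_cell hn h hs)) _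

lemma measureReal_Ico_eq_sub {σ : Measure ℝ} [IsProbabilityMeasure σ] {a b : ℝ} (hab : a ≤ b) :
    σ.real (Set.Ico a b) = σ.real (Set.Iio b) - σ.real (Set.Iio a) := by
  rw [← measureReal_sdiff (Set.Iio_subset_Iio hab) measurableSet_Iio]
  congr 1
  ext x
  simp

lemma sum_measureReal_cell {σ : Measure ℝ} [IsProbabilityMeasure σ] {n : ℕ} (hn : 0 < n)
    (i j : ℕ) :
    ∑ l ∈ range n, σ.real (cell n (i + 1) (j * n + l)) = σ.real (cell n i j) := by
  have hn' : (0 : ℝ) < n := by exact_mod_cast hn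
  set F : ℕ → ℝ := fun l => σ.real (Set.Iio (((j * n + l : ℕ) : ℝ) / (n : ℝ) ^ (i + 1))) with hF
  have h : ∀ l, σ.real (cell n (i + 1) (j * n + l)) = F (l + 1) - F l := by
    intro l
    rw [cell, measureReal_Ico_eq_sub (by gcongr; linarith)]
    simp only [hF]
    push_cast
    simp only [add_assoc]
  simp only [h]
  rw [sum_range_sub, cell, measureReal_Ico_eq_sub (by gcongr; linarith)]
  have h1 : ((j * n + n : ℕ) : ℝ) / (n : ℝ) ^ (i + 1) = (j + 1) / (n : ℝ) ^ i := by
    push_cast; rw [pow_succ]; field_simp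
  have h2 : ((j * n + 0 : ℕ) : ℝ) / (n : ℝ) ^ (i + 1) = j / (n : ℝ) ^ i := by
    push_cast; rw [pow_succ]; field_simp; ring
  simp only [hF, h1, h2]

lemma sum_measureReal_cell_eq_one {σ : Measure ℝ} [IsProbabilityMeasure σ] {n : ℕ}
    (hn : 0 < n) (hσ : σ (Set.Ico 0 1) = 1) (i : ℕ) :
    ∑ J ∈ range (n ^ i), σ.real (cell n i J) = 1 := by
  induction i with
  | zero => simp [cell, measureReal_def, hσ]
  | succ i ih =>
    rw [pow_succ, sum_range_mul_eq_sum_sum]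
    simp only [sum_measureReal_cell hn, ih]

/-- The entropy of `σ` with respect to the partition of `[0,1)` into `n`-adic intervals of
level `i`. -/
def cellEntropy (n : ℕ) (σ : Measure ℝ) (i : ℕ) : ℝ :=
  ∑ J ∈ range (n ^ i), negMulLog (σ.real (cell n i J))

lemma cellEntropy_zero (n : ℕ) {σ : Measure ℝ} (hσ : σ (Set.Ico 0 1) = 1) :
    cellEntropy n σ 0 = 0 := by
  simp [cellEntropy, cell, measureReal_def, hσ]

lemma cellEntropy_nonneg (σ : Measure ℝ) [IsProbabilityMeasure σ] (n i : ℕ) :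
    0 ≤ cellEntropy n σ i :=
  sum_nonneg fun _ _ => negMulLog_nonneg measureReal_nonneg measureReal_le_one

lemma negMulLog_le_one {x : ℝ} (hx : 0 ≤ x) : negMulLog x ≤ 1 := by
  rcases hx.eq_or_lt with rfl | h
  · simp
  · have h1 := one_sub_inv_le_log_of_pos h
    have h2 : x * x⁻¹ = 1 := mul_inv_cancel₀ h.ne'
    rw [negMulLog]
    nlinarith [mul_le_mul_of_nonneg_left h1 hx]

lemma cellEntropy_le (σ : Measure ℝ) (n i : ℕ) : cellEntropy n σ i ≤ (n : ℝ) ^ i := by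
  refine (sum_le_sum (g := fun _ => (1 : ℝ)) fun _ _ => negMulLog_le_one measureReal_nonneg).trans ?_
  simp

/-- Weak Pinsker inside each parent cell; by the chain rule the conditional entropies add up to the
entropy gain between the two levels. -/
lemma sum_abs_cell_sub_average_le {σ : Measure ℝ} [IsProbabilityMeasure σ] {n : ℕ}
    (hn : 0 < n) (hσ : σ (Set.Ico 0 1) = 1) (i : ℕ)
    {η : ℝ} (hη : 0 < η) :
    ∑ j ∈ range (n ^ i), ∑ l ∈ range n,
        |σ.real (cell n (i + 1) (j * n + l)) - σ.real (cell n i j) / n| ≤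
      η + (n + 1) / (2 * η) * (log n - (cellEntropy n σ (i + 1) - cellEntropy n σ i)) := by
  refine (sum_le_sum fun j _ => sum_abs_sub_average_le hn (fun l => measureReal_nonneg)
    (sum_measureReal_cell hn i j) hη).trans_eq ?_
  rw [sum_add_distrib, ← mul_sum, ← mul_sum, sum_sub_distrib, sum_sub_distrib, ← sum_mul,
    sum_measureReal_cell_eq_one hn hσ, cellEntropy, cellEntropy, pow_succ,
    sum_range_mul_eq_sum_sum]
  ring

lemma abs_integral_sub_sum_le {σ : Measure ℝ} [IsProbabilityMeasure σ] {n : ℕ}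
    (hn : 0 < n) (hσ : σ (Set.Ico 0 1) = 1) (i : ℕ)
    {h : ℝ → ℝ} (hh : Integrable h σ) {d : ℕ → ℝ} {ε : ℝ}
    (hd : ∀ J, ∀ s ∈ cell n i J, |h s - d J| ≤ ε) :
    |∫ s, h s ∂σ - ∑ J ∈ range (n ^ i), σ.real (cell n i J) * d J| ≤ ε := by
  have hint : ∀ J ∈ range (n ^ i), Integrable ((cell n i J).indicator fun _ => d J) σ :=
    fun J _ => (integrable_const _).indicator (measurableSet_cell n i J)
  have h1 : ∑ J ∈ range (n ^ i), σ.real (cell n i J) * d J =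
      ∫ s, ∑ J ∈ range (n ^ i), (cell n i J).indicator (fun _ => d J) s ∂σ := by
    rw [integral_finsetSum _ hint]
    refine sum_congr rfl fun J _ => ?_
    rw [integral_indicator_const _ (measurableSet_cell n i J), smul_eq_mul]
  rw [h1, ← integral_sub hh (integrable_finsetSum _ hint)]
  have hae : ∀ᵐ s ∂σ, ‖h s - ∑ J ∈ range (n ^ i), (cell n i J).indicator (fun _ => d J) s‖ ≤ ε := by
    have : ∀ᵐ s ∂σ, s ∈ Set.Ico (0 : ℝ) 1 := (prob_compl_eq_zero_iff measurableSet_Ico).2 hσ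
    filter_upwards [this] with s hs
    obtain ⟨J, hJ, hsJ⟩ := exists_mem_cell i hn hs
    rw [sum_indicator_cell hn hJ hsJ]
    exact hd J s hsJ
  simpa using norm_integral_le_of_norm_le_const hae

/-- Comparison of a function along `σ`, magnified by `n ^ i`, with its translate by `L / n`:
the difference is controlled by the defect of the entropy gained from level `i` to `i + 1`. -/
lemma abs_integral_sub_shift_le {σ : Measure ℝ} [IsProbabilityMeasure σ] {n L : ℕ}
    (hn : 0 < n) (hσ : σ (Set.Ico 0 1) = 1) (i : ℕ)
    {k : ℝ → ℝ} (hk : Measurable k) {M ε : ℝ} (hM : ∀ r, |k r| ≤ M)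
    (hε : ∀ r r' : ℝ, |r' - r| ≤ 1 / n → |k r' - k r| ≤ ε) {η : ℝ} (hη : 0 < η) :
    |∫ s, (k ((n : ℝ) ^ i * s) - k ((n : ℝ) ^ i * s + L / n)) ∂σ| ≤
      2 * ε + 2 * M * (L / n) + 2 * M * (η + (n + 1) / (2 * η) *
        (log n - (cellEntropy n σ (i + 1) - cellEntropy n σ i))) := by
  have hn' : (0 : ℝ) < n := by exact_mod_cast hn
  have hM0 : 0 ≤ M := (abs_nonneg _).trans (hM 0)
  -- Magnified by `n ^ i`, the `J`-th cell of level `i + 1` starts at `J / n`, so a shift by `L / n`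
  -- is a shift of the index by `L`. Sampling both terms at left endpoints costs `2 * ε`.
  set d : ℕ → ℝ := fun J => k (J / n) - k ((J + L : ℕ) / n) with hd
  have hdM : ∀ J, |d J| ≤ 2 * M := fun J => by
    have := abs_sub (k (J / n)) (k ((J + L : ℕ) / n))
    linarith [hM (J / n), hM ((J + L : ℕ) / n)]
  have hint : Integrable (fun s => k ((n : ℝ) ^ i * s) - k ((n : ℝ) ^ i * s + L / n)) σ := by
    refine Integrable.of_bound (C := 2 * M) (by fun_prop) (ae_of_all _ fun s => ?_)
    rw [Real.norm_eq_abs]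
    have := abs_sub (k ((n : ℝ) ^ i * s)) (k ((n : ℝ) ^ i * s + L / n))
    linarith [hM ((n : ℝ) ^ i * s), hM ((n : ℝ) ^ i * s + L / n)]
  have h1 := abs_integral_sub_sum_le (d := d) (ε := 2 * ε) hn hσ (i + 1) hint (by
    intro J s hs
    rw [mem_cell hn, pow_succ] at hs
    have hA : |(n : ℝ) ^ i * s - J / n| ≤ 1 / n := by
      rw [abs_le]
      constructor
      · rw [neg_le_sub_iff_le_add, div_le_iff₀ hn', add_mul, one_div, inv_mul_cancel₀ hn'.ne']
        linarith
      · rw [sub_le_iff_le_add, ← add_div, le_div_iff₀ hn']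
        linarith
    have hB : |(n : ℝ) ^ i * s + L / n - ((J + L : ℕ) : ℝ) / n| ≤ 1 / n := by
      convert hA using 2
      push_cast; ring
    have h2 := hε _ _ hA
    have h3 := hε _ _ hB
    rw [hd]
    simp only
    rw [abs_le] at h2 h3 ⊢
    constructor <;> linarith [h2.1, h2.2, h3.1, h3.2])
  have h2 : |∑ J ∈ range (n ^ (i + 1)), σ.real (cell n (i + 1) J) * d J| ≤
      2 * M * (L / n) + 2 * M * (η + (n + 1) / (2 * η) *
        (log n - (cellEntropy n σ (i + 1) - cellEntropy n σ i))) := by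
    -- Spread the mass of each parent evenly over its children: the even part nearly cancels under
    -- the shift, and the deviation from it is the Pinsker term.
    have hsplit : ∑ J ∈ range (n ^ (i + 1)), σ.real (cell n (i + 1) J) * d J =
        (∑ j ∈ range (n ^ i), σ.real (cell n i j) / n * ∑ l ∈ range n, d (j * n + l)) +
        ∑ j ∈ range (n ^ i), ∑ l ∈ range n,
          (σ.real (cell n (i + 1) (j * n + l)) - σ.real (cell n i j) / n) * d (j * n + l) := by
      rw [pow_succ, sum_range_mul_eq_sum_sum, ← sum_add_distrib]
      refine sum_congr rfl fun j _ => ?_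
      rw [mul_sum, ← sum_add_distrib]
      exact sum_congr rfl fun l _ => by ring
    rw [hsplit]
    refine (abs_add_le _ _).trans (add_le_add ?_ ?_)
    · refine (abs_sum_le_sum_abs _ _).trans ?_
      have : ∀ j ∈ range (n ^ i), |σ.real (cell n i j) / n * ∑ l ∈ range n, d (j * n + l)| ≤
          σ.real (cell n i j) * (2 * M * (L / n)) := by
        intro j _
        rw [abs_mul, abs_of_nonneg (div_nonneg measureReal_nonneg hn'.le)]
        have h3 := abs_sum_sub_shift_le (κ := fun l => k (((j * n + l : ℕ) : ℝ) / n))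
          (fun l => hM _) n L
        calc _ ≤ σ.real (cell n i j) / n * (2 * M * L) := by
              refine mul_le_mul_of_nonneg_left ?_ (div_nonneg measureReal_nonneg hn'.le)
              simpa only [hd, add_assoc] using h3
          _ = _ := by ring
      refine (sum_le_sum this).trans_eq ?_
      rw [← sum_mul, sum_measureReal_cell_eq_one hn hσ, one_mul]
    · refine le_trans ?_ (mul_le_mul_of_nonneg_left (sum_abs_cell_sub_average_le hn hσ i hη)
        (by positivity : 0 ≤ 2 * M))
      rw [mul_sum]
      refine (abs_sum_le_sum_abs _ _).trans (sum_le_sum fun j _ => ?_)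
      rw [mul_sum]
      refine (abs_sum_le_sum_abs _ _).trans (sum_le_sum fun l _ => ?_)
      rw [abs_mul, mul_comm]
      exact mul_le_mul_of_nonneg_right (hdM _) (abs_nonneg _)
  have h3 := abs_sub_abs_le_abs_sub (∫ s, (k ((n : ℝ) ^ i * s) - k ((n : ℝ) ^ i * s + L / n)) ∂σ)
    (∑ J ∈ range (n ^ (i + 1)), σ.real (cell n (i + 1) J) * d J)
  linarith

end Cells

/-! ### Normalised leafwise measures on the unit interval -/

section Disintegration

open ProbabilityTheory

variable {X : Type*} [MeasurableSpace X]

/-- The law of `(u(-s) x, s)` where `x` has law `μ` and `s` is uniform on `[0,1)`. -/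
def jointLaw (φ : ℝ → X → X) (μ : Measure X) : Measure (X × ℝ) :=
  (μ.prod (volume.restrict (Set.Ico 0 1))).map fun p => (φ (-p.2) p.1, p.2)

instance isProbabilityMeasure_uniform :
    IsProbabilityMeasure (volume.restrict (Set.Ico (0 : ℝ) 1)) :=
  ⟨by simp⟩

/-- The density of the uniform distribution on `[0,1)`. -/
def unitDensity : ℝ → ℝ≥0 := (Set.Ico (0 : ℝ) 1).indicator 1

lemma coe_unitDensity (s : ℝ) :
    (unitDensity s : ℝ≥0∞) = (Set.Ico (0 : ℝ) 1).indicator 1 s := by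
  by_cases h : s ∈ Set.Ico (0 : ℝ) 1 <;> simp [unitDensity, h]

lemma measurable_unitDensity : Measurable unitDensity :=
  measurable_one.indicator measurableSet_Ico

lemma lintegral_unitDensity_mul (m : Measure ℝ) (g : ℝ → ℝ≥0∞) :
    ∫⁻ s, (unitDensity s : ℝ≥0∞) * g s ∂m = ∫⁻ s in Set.Ico (0 : ℝ) 1, g s ∂m := by
  rw [← lintegral_indicator measurableSet_Ico]
  refine lintegral_congr fun s => ?_
  rw [coe_unitDensity]
  by_cases h : s ∈ Set.Ico (0 : ℝ) 1 <;> simp [h]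

lemma lintegral_unitDensity (m : Measure ℝ) :
    ∫⁻ s, (unitDensity s : ℝ≥0∞) ∂m = m (Set.Ico (0 : ℝ) 1) := by
  simpa using lintegral_unitDensity_mul m 1

variable {φ : ℝ → X → X}

lemma measurable_skew (hφ : Measurable fun p : X × ℝ => φ (-p.2) p.1) :
    Measurable fun p : X × ℝ => (φ (-p.2) p.1, p.2) :=
  hφ.prodMk measurable_snd

variable {μ : Measure X}

lemma antiConv_unitDensity (hφ : Measurable fun p : X × ℝ => φ (-p.2) p.1) :
    antiConv φ unitDensity μ = (jointLaw φ μ).fst := by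
  have h : (fun s => (unitDensity s : ℝ≥0∞)) = (Set.Ico (0 : ℝ) 1).indicator 1 :=
    funext coe_unitDensity
  rw [antiConv, h, withDensity_indicator_one measurableSet_Ico, jointLaw, Measure.fst,
    Measure.map_map measurable_fst (measurable_skew hφ)]
  rfl

variable [IsProbabilityMeasure μ]

lemma isProbabilityMeasure_jointLaw (hφ : Measurable fun p : X × ℝ => φ (-p.2) p.1) :
    IsProbabilityMeasure (jointLaw φ μ) :=
  Measure.isProbabilityMeasure_map (measurable_skew hφ).aemeasurable

lemma lintegral_jointLaw (hφ : Measurable fun p : X × ℝ => φ (-p.2) p.1)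
    {g : X × ℝ → ℝ≥0∞} (hg : Measurable g) :
    ∫⁻ p, g p ∂(jointLaw φ μ) = ∫⁻ p, (unitDensity p.2 : ℝ≥0∞) * g p ∂(skewMeasure φ μ) := by
  have hu : Measurable fun p : X × ℝ => (unitDensity p.2 : ℝ≥0∞) :=
    (measurable_unitDensity.comp measurable_snd).coe_nnreal_ennreal
  rw [jointLaw, skewMeasure, lintegral_map hg (measurable_skew hφ),
    lintegral_map (by fun_prop) (measurable_skew hφ)]
  have h : μ.prod (volume.restrict (Set.Ico (0 : ℝ) 1)) =
      (μ.prod volume).restrict (Set.univ ×ˢ Set.Ico (0 : ℝ) 1) := by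
    rw [← Measure.prod_restrict, Measure.restrict_univ]
  rw [h, ← lintegral_indicator (MeasurableSet.univ.prod measurableSet_Ico)]
  refine lintegral_congr fun p => ?_
  dsimp only
  rw [coe_unitDensity]
  by_cases h : p.2 ∈ Set.Ico (0 : ℝ) 1 <;> simp [Set.indicator, h]

/-- The kernel normalises `ν y` on `[0,1)`, and the disintegration is the defining property for the
uniform density. The final domination comes from translation equivariance: it carries the local
dimension of `ν x` at `0` to that of `κ (φ (-s) x)` at `s`. -/
lemma exists_unit_kernel (hφ : Measurable fun p : X × ℝ => φ (-p.2) p.1) {ν : X → Measure ℝ}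
    (hν : IsLeafwiseFamily φ μ ν) :
    ∃ κ : Kernel X ℝ, IsMarkovKernel κ ∧ (∀ y, κ y (Set.Ico 0 1) = 1) ∧
      jointLaw φ μ = (jointLaw φ μ).fst ⊗ₘ κ ∧
      ∀ᵐ p ∂(μ.prod (volume.restrict (Set.Ico (0 : ℝ) 1))), ∃ c : ℝ≥0∞, c ≠ ∞ ∧
        ∀ A, MeasurableSet A → κ (φ (-p.2) p.1) A ≤ c * ν p.1 {r | r + p.2 ∈ A} := by
  classical
  set I : Set ℝ := Set.Ico 0 1 with hI
  have hIm : MeasurableSet I := measurableSet_Ico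
  have hνA : ∀ A, MeasurableSet A → Measurable fun y => ν y A := fun A hA =>
    (Measure.measurable_coe hA).comp hν.measurable
  set good : Set X := {y | 0 < ν y I ∧ ν y I < ∞} with hgood
  have hgm : MeasurableSet good :=
    (measurableSet_lt measurable_const (hνA I hIm)).inter
      (measurableSet_lt (hνA I hIm) measurable_const)
  -- The Dirac mass on the exceptional null set makes `κ y` a probability measure carried by `[0,1)`
  -- for every `y`.
  have hκm : Measurable fun y => if y ∈ good then (ν y I)⁻¹ • (ν y).restrict I
      else Measure.dirac 0 := by
    refine Measurable.ite hgm ?_ measurable_const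
    refine Measure.measurable_of_measurable_coe _ fun A hA => ?_
    simp only [Measure.smul_apply, Measure.restrict_apply hA, smul_eq_mul]
    exact (hνA I hIm).inv.mul (hνA _ (hA.inter hIm))
  set κ : Kernel X ℝ := ⟨_, hκm⟩ with hκ
  have hκg : ∀ y ∈ good, κ y = (ν y I)⁻¹ • (ν y).restrict I := fun y hy => if_pos hy
  have hκb : ∀ y ∉ good, κ y = Measure.dirac 0 := fun y hy => if_neg hy
  have hκI : ∀ y, κ y I = 1 := by
    intro y
    by_cases hy : y ∈ good
    · rw [hκg y hy, Measure.smul_apply, Measure.restrict_apply_self, smul_eq_mul,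
        ENNReal.inv_mul_cancel hy.1.ne' hy.2.ne]
    · rw [hκb y hy, Measure.dirac_apply' _ hIm]
      simp [hI]
  have hmk : IsMarkovKernel κ := ⟨fun y => ⟨by
    by_cases hy : y ∈ good
    · rw [hκg y hy, Measure.smul_apply, Measure.restrict_apply_univ, smul_eq_mul,
        ENNReal.inv_mul_cancel hy.1.ne' hy.2.ne]
    · rw [hκb y hy]; simp⟩⟩
  have hmass : ∫⁻ s, (unitDensity s : ℝ≥0∞) = 1 := by
    rw [lintegral_unitDensity]; simp
  have hae : ∀ᵐ y ∂(jointLaw φ μ).fst, y ∈ good := by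
    have := hν.pos_finite unitDensity measurable_unitDensity hmass
    rw [antiConv_unitDensity hφ] at this
    filter_upwards [this] with y hy
    rwa [lintegral_unitDensity] at hy
  have := isProbabilityMeasure_jointLaw (μ := μ) hφ
  refine ⟨κ, hmk, hκI, ?_, ?_⟩
  · ext S hS
    have hg : Measurable (S.indicator (1 : X × ℝ → ℝ≥0∞)) := measurable_one.indicator hS
    rw [Measure.compProd_apply hS, ← lintegral_indicator_one hS, lintegral_jointLaw hφ hg,
      hν.disintegration unitDensity measurable_unitDensity hmass _ hg, antiConv_unitDensity hφ]
    refine lintegral_congr_ae ?_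
    filter_upwards [hae] with y hy
    have hSy : MeasurableSet (Prod.mk y ⁻¹' S) := measurable_prodMk_left hS
    rw [lintegral_unitDensity, lintegral_unitDensity_mul, hκg y hy, Measure.smul_apply,
      smul_eq_mul, ENNReal.div_eq_inv_mul, ← lintegral_indicator_one hSy]
    rfl
  · rw [jointLaw, Measure.fst, Measure.map_map measurable_fst (measurable_skew hφ)] at hae
    have hae' := ae_of_ae_map (measurable_fst.comp (measurable_skew hφ)).aemeasurable hae
    filter_upwards [hae'] with p hp
    obtain ⟨c, hc, hνc⟩ := hν.translate (-p.2) p.1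
    have hp' : φ (-p.2) p.1 ∈ good := hp
    refine ⟨(ν (φ (-p.2) p.1) I)⁻¹ * c, ENNReal.mul_ne_top (ENNReal.inv_ne_top.2 hp'.1.ne')
      ENNReal.coe_ne_top, fun A hA => ?_⟩
    rw [hκg _ hp', Measure.smul_apply, smul_eq_mul, mul_assoc]
    refine mul_le_mul_right ((Measure.restrict_apply_le _ _).trans ?_) _
    rw [hνc, Measure.smul_apply, Measure.map_apply (by fun_prop) hA]
    simp only [sub_neg_eq_add]
    exact le_rfl

end Disintegration

/-! ### Entropy growth from the local dimension -/

section EntropyLowerBound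

open ProbabilityTheory Finset

/-- The information `-log q` of an event of probability `q`. -/
def information (q : ℝ≥0∞) : ℝ≥0∞ := if q = 0 then ∞ else ENNReal.ofReal (-Real.log q.toReal)

lemma measurable_information : Measurable information :=
  Measurable.ite (measurableSet_singleton 0) measurable_const (by fun_prop)

lemma information_mul_self {q : ℝ≥0∞} (hq : q ≠ ∞) :
    information q * q = ENNReal.ofReal (Real.negMulLog q.toReal) := by
  rcases eq_or_ne q 0 with rfl | h
  · simp
  · rw [information, if_neg h]
    nth_rw 2 [← ENNReal.ofReal_toReal hq]
    rw [← ENNReal.ofReal_mul' ENNReal.toReal_nonneg, Real.negMulLog]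
    congr 1; ring

/-- Null events have infinite information, and otherwise `hq` forces `c * m ≠ 0`; hence no separate
assumption on `c` or `m`. -/
lemma le_information {q : ℝ≥0∞} {c m : ℝ} (hq : q.toReal ≤ c * m) (hq' : q ≠ ∞) :
    ENNReal.ofReal (-Real.log c - Real.log m) ≤ information q := by
  rcases eq_or_ne q 0 with rfl | h
  · simp [information]
  · rw [information, if_neg h]
    have h0 : 0 < q.toReal := ENNReal.toReal_pos h hq'
    have hcm : c * m ≠ 0 := (h0.trans_le hq).ne'
    have := Real.log_le_log h0 hq
    rw [Real.log_mul (left_ne_zero_of_mul hcm) (right_ne_zero_of_mul hcm)] at this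
    exact ENNReal.ofReal_le_ofReal (by linarith)

variable {X : Type*} [MeasurableSpace X]

/-- The information of the `n`-adic interval of level `N` containing `s`, for the measure `κ y`. -/
def cellInformation (κ : Kernel X ℝ) (n N : ℕ) (p : X × ℝ) : ℝ≥0∞ :=
  ∑ J ∈ range (n ^ N), (cell n N J).indicator (fun _ => information (κ p.1 (cell n N J))) p.2

lemma measurable_cellInformation (κ : Kernel X ℝ) (n N : ℕ) :
    Measurable (cellInformation κ n N) := by
  refine Finset.measurable_sum _ fun J _ => ?_
  have h : (fun p : X × ℝ => (cell n N J).indicator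
      (fun _ => information (κ p.1 (cell n N J))) p.2) =
      (Prod.snd ⁻¹' cell n N J).indicator
        fun p : X × ℝ => information (κ p.1 (cell n N J)) := by
    ext p; by_cases h : p.2 ∈ cell n N J <;> simp [Set.indicator, h]
  rw [h]
  refine Measurable.indicator ?_ (measurable_snd (measurableSet_cell n N J))
  exact measurable_information.comp
    ((κ.measurable_coe (measurableSet_cell n N J)).comp measurable_fst)

lemma measurable_cellEntropy (κ : Kernel X ℝ) (n N : ℕ) :
    Measurable fun y => cellEntropy n (κ y) N := by
  refine Finset.measurable_sum _ fun J _ => ?_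
  exact Real.continuous_negMulLog.measurable.comp
    (κ.measurable_coe (measurableSet_cell n N J)).ennreal_toReal

lemma integrable_cellEntropy (lam : Measure X) [IsFiniteMeasure lam] (κ : Kernel X ℝ)
    [IsMarkovKernel κ] (n N : ℕ) : Integrable (fun y => cellEntropy n (κ y) N) lam :=
  Integrable.of_bound (C := (n : ℝ) ^ N) (measurable_cellEntropy κ n N).aestronglyMeasurable
    (ae_of_all _ fun y => by
      rw [Real.norm_of_nonneg (cellEntropy_nonneg _ n N)]
      exact cellEntropy_le _ n N)

lemma lintegral_cellInformation (lam : Measure X) [IsFiniteMeasure lam] (κ : Kernel X ℝ)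
    [IsMarkovKernel κ] (n N : ℕ) :
    ∫⁻ p, cellInformation κ n N p ∂(lam ⊗ₘ κ) =
      ENNReal.ofReal (∫ y, cellEntropy n (κ y) N ∂lam) := by
  rw [Measure.lintegral_compProd (measurable_cellInformation κ n N),
    ofReal_integral_eq_lintegral_ofReal (integrable_cellEntropy lam κ n N)
      (ae_of_all _ fun y => cellEntropy_nonneg _ n N)]
  refine lintegral_congr fun y => ?_
  simp only [cellInformation]
  rw [lintegral_finsetSum _ fun J _ => measurable_const.indicator (measurableSet_cell n N J),
    cellEntropy, ENNReal.ofReal_sum_of_nonneg fun J _ =>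
      Real.negMulLog_nonneg measureReal_nonneg measureReal_le_one]
  refine sum_congr rfl fun J _ => ?_
  rw [lintegral_indicator_const (measurableSet_cell n N J),
    information_mul_self (measure_ne_top _ _)]
  rfl

/-- At points where `κ y` is dominated by a multiple of a translate of `m`, whose local dimension
at `0` is `δ`, the information of the cells grows at rate at least `δ log n`. -/
lemma le_liminf_cellInformation {n : ℕ} (hn : 2 ≤ n) {κ : Kernel X ℝ} [IsMarkovKernel κ]
    {y : X} {s : ℝ} (hs : s ∈ Set.Ico (0 : ℝ) 1) {m : Measure ℝ} [IsLocallyFiniteMeasure m]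
    {c : ℝ≥0∞} (hc : c ≠ ∞)
    (hκ : ∀ A, MeasurableSet A → κ y A ≤ c * m {r | r + s ∈ A}) {δ : ℝ}
    (hδ : Tendsto (fun t : ℝ => 1 / t * Real.log (m.real (Set.Icc (-Real.exp (-t)) (Real.exp (-t)))))
      atTop (𝓝 (-δ))) :
    ENNReal.ofReal (δ * Real.log n) ≤
      liminf (fun N : ℕ => ENNReal.ofReal (1 / N) * cellInformation κ n N (y, s)) atTop := by
  have hn0 : 0 < n := by omega
  have hn' : (0 : ℝ) < n := by exact_mod_cast hn0
  have hlog : 0 < Real.log n := Real.log_pos (by exact_mod_cast (by omega : 1 < n))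
  set M : ℕ → ℝ := fun N =>
    m.real (Set.Icc (-Real.exp (-(N * Real.log n))) (Real.exp (-(N * Real.log n)))) with hM
  have ht : Tendsto (fun N : ℕ => (N : ℝ) * Real.log n) atTop atTop :=
    tendsto_natCast_atTop_atTop.atTop_mul_const hlog
  have hinv : Tendsto (fun N : ℕ => 1 / (N : ℝ)) atTop (𝓝 0) := tendsto_one_div_atTop_nhds_zero_nat
  have hlim : Tendsto (fun N : ℕ => ENNReal.ofReal
      (1 / N * (-Real.log c.toReal - Real.log (M N)))) atTop
      (𝓝 (ENNReal.ofReal (δ * Real.log n))) := by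
    -- Sample the dimension limit at `t = N log n`; the factor `1 / N` removes the constant `c`.
    refine ENNReal.tendsto_ofReal ?_
    have h1 := (hinv.mul_const (-Real.log c.toReal)).sub ((hδ.comp ht).mul_const (Real.log n))
    have h2 : 0 * -Real.log c.toReal - -δ * Real.log n = δ * Real.log n := by ring
    rw [h2] at h1
    refine h1.congr fun N => ?_
    simp only [Function.comp, hM]
    field_simp
  rw [← hlim.liminf_eq]
  refine liminf_le_liminf (Eventually.of_forall fun N => ?_)
  rw [ENNReal.ofReal_mul (by positivity)]
  refine mul_le_mul_right ?_ _
  obtain ⟨J, hJ, hsJ⟩ := exists_mem_cell N hn0 hs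
  have hval : cellInformation κ n N (y, s) = information (κ y (cell n N J)) := by
    rw [cellInformation]
    exact sum_indicator_cell hn0 hJ hsJ fun J => information (κ y (cell n N J))
  rw [hval]
  refine le_information ?_ (measure_ne_top _ _)
  have hexp : Real.exp (-(N * Real.log n)) = ((n : ℝ) ^ N)⁻¹ := by
    rw [Real.exp_neg, Real.exp_nat_mul, Real.exp_log hn']
  -- A cell of length `n ^ (-N)` containing `s` lies within that distance of `s`.
  have hsub : {r | r + s ∈ cell n N J} ⊆
      Set.Icc (-Real.exp (-(N * Real.log n))) (Real.exp (-(N * Real.log n))) := by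
    intro r hr
    rw [Set.mem_ofPred_eq, mem_cell hn0] at hr
    rw [mem_cell hn0] at hsJ
    have hp : (0 : ℝ) < (n : ℝ) ^ N := by positivity
    rw [hexp, Set.mem_Icc]
    have hpi := mul_inv_cancel₀ hp.ne'
    constructor <;> refine le_of_mul_le_mul_left ?_ hp <;> nlinarith [hr.1, hr.2, hsJ.1, hsJ.2]
  have hle := (hκ _ (measurableSet_cell n N J)).trans (mul_le_mul_right (measure_mono hsub) c)
  have hfin : m (Set.Icc (-Real.exp (-(N * Real.log n))) (Real.exp (-(N * Real.log n)))) ≠ ∞ :=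
    isCompact_Icc.measure_lt_top.ne
  have := ENNReal.toReal_mono (ENNReal.mul_ne_top hc hfin) hle
  rwa [ENNReal.toReal_mul] at this

/-- Mean information is mean entropy, so Fatou's lemma turns the pointwise growth rate into a bound
in the mean. A single level `N` suffices for the telescoping argument, so no uniformity is needed.
-/
lemma exists_le_integral_cellEntropy {φ : ℝ → X → X}
    (hφ : Measurable fun p : X × ℝ => φ (-p.2) p.1) {μ : Measure X} [IsProbabilityMeasure μ]
    {κ : Kernel X ℝ} [IsMarkovKernel κ] (hκ : jointLaw φ μ = (jointLaw φ μ).fst ⊗ₘ κ)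
    {ν : X → Measure ℝ} (hν : ∀ y, IsLocallyFiniteMeasure (ν y))
    (hκν : ∀ᵐ p ∂(μ.prod (volume.restrict (Set.Ico (0 : ℝ) 1))), ∃ c : ℝ≥0∞, c ≠ ∞ ∧
        ∀ A, MeasurableSet A → κ (φ (-p.2) p.1) A ≤ c * ν p.1 {r | r + p.2 ∈ A})
    {δ : ℝ} (hδ : ∀ᵐ x ∂μ, Tendsto
      (fun t : ℝ => 1 / t * Real.log ((ν x).real (Set.Icc (-Real.exp (-t)) (Real.exp (-t)))))
      atTop (𝓝 (-δ)))
    {n : ℕ} (hn : 2 ≤ n) {b : ℝ} (hb : 0 ≤ b) (hbδ : b < δ * Real.log n) :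
    ∃ N : ℕ, 0 < N ∧ N * b ≤ ∫ y, cellEntropy n (κ y) N ∂(jointLaw φ μ).fst := by
  have := isProbabilityMeasure_jointLaw (μ := μ) hφ
  have hF := measurable_skew hφ
  have hint : ∀ N : ℕ, ∫⁻ p, ENNReal.ofReal (1 / N) * cellInformation κ n N (φ (-p.2) p.1, p.2)
      ∂(μ.prod (volume.restrict (Set.Ico (0 : ℝ) 1))) =
      ENNReal.ofReal (1 / N * ∫ y, cellEntropy n (κ y) N ∂(jointLaw φ μ).fst) := by
    intro N
    have hm : Measurable fun p : X × ℝ => cellInformation κ n N (φ (-p.2) p.1, p.2) :=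
      (measurable_cellInformation κ n N).comp hF
    rw [lintegral_const_mul _ hm,
      ← lintegral_map (measurable_cellInformation κ n N) hF, ENNReal.ofReal_mul (by positivity),
      ← lintegral_cellInformation, ← hκ]
    rfl
  have hae : ∀ᵐ p ∂(μ.prod (volume.restrict (Set.Ico (0 : ℝ) 1))),
      ENNReal.ofReal (δ * Real.log n) ≤ liminf (fun N : ℕ =>
        ENNReal.ofReal (1 / N) * cellInformation κ n N (φ (-p.2) p.1, p.2)) atTop := by
    have h1 : ∀ᵐ p ∂(μ.prod (volume.restrict (Set.Ico (0 : ℝ) 1))), p.2 ∈ Set.Ico (0 : ℝ) 1 :=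
      Measure.quasiMeasurePreserving_snd.ae (ae_restrict_mem measurableSet_Ico)
    have h2 := Measure.quasiMeasurePreserving_fst (μ := μ)
      (ν := volume.restrict (Set.Ico (0 : ℝ) 1)) |>.ae hδ
    filter_upwards [h1, h2, hκν] with p hp1 hp2 ⟨c, hc, hpc⟩
    exact le_liminf_cellInformation hn hp1 hc hpc hp2
  have hfatou : ENNReal.ofReal (δ * Real.log n) ≤ liminf (fun N : ℕ =>
      ENNReal.ofReal (1 / N * ∫ y, cellEntropy n (κ y) N ∂(jointLaw φ μ).fst)) atTop := by
    simp only [← hint]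
    calc ENNReal.ofReal (δ * Real.log n)
        = ∫⁻ _, ENNReal.ofReal (δ * Real.log n)
            ∂(μ.prod (volume.restrict (Set.Ico (0 : ℝ) 1))) := by simp
      _ ≤ _ := lintegral_mono_ae hae
      _ ≤ _ := lintegral_liminf_le fun N =>
        ((measurable_cellInformation κ n N).comp hF).const_mul _
  have hlt : ENNReal.ofReal b < liminf (fun N : ℕ =>
      ENNReal.ofReal (1 / N * ∫ y, cellEntropy n (κ y) N ∂(jointLaw φ μ).fst)) atTop :=
    ((ENNReal.ofReal_lt_ofReal_iff (hb.trans_lt hbδ)).2 hbδ).trans_le hfatou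
  obtain ⟨N, hN, hN0⟩ := ((eventually_lt_of_lt_liminf hlt).and (eventually_gt_atTop 0)).exists
  refine ⟨N, hN0, ?_⟩
  have hN' : (0 : ℝ) < N := by exact_mod_cast hN0
  have h := (ENNReal.ofReal_lt_ofReal_iff_of_nonneg hb).1 hN
  rw [one_div, inv_mul_eq_div, lt_div_iff₀ hN'] at h
  linarith

end EntropyLowerBound

/-! ### The action of `B` and uniform continuity along `u`-orbits -/

section Action

lemma u_add (s r : ℝ) : u (s + r) = u s * u r := by
  refine Subtype.ext (Matrix.SpecialLinearGroup.ext _ _ fun i j => ?_)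
  rw [Subgroup.coe_mul, Matrix.SpecialLinearGroup.coe_mul]
  simp only [u, uMat]
  fin_cases i <;> fin_cases j <;> simp [Matrix.mul_apply, add_comm]

lemma u_zero : u 0 = 1 := by
  have h := u_add 0 0
  rw [add_zero] at h
  exact left_eq_mul.1 h

lemma a_mul_u (t s : ℝ) : a t * u s = u (Real.exp t * s) * a t := by
  refine Subtype.ext (Matrix.SpecialLinearGroup.ext _ _ fun i j => ?_)
  rw [Subgroup.coe_mul, Subgroup.coe_mul, Matrix.SpecialLinearGroup.coe_mul,
    Matrix.SpecialLinearGroup.coe_mul]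
  simp only [u, uMat, a, aMat]
  fin_cases i <;> fin_cases j <;> simp [Matrix.mul_apply]
  have h : Real.exp t = Real.exp (t / 2) * Real.exp (t / 2) := by
    rw [← Real.exp_add]; congr 1; ring
  have h' : Real.exp (t / 2) * Real.exp (-(t / 2)) = 1 := by
    rw [← Real.exp_add]; simp
  rw [h]
  linear_combination (-Real.exp (t / 2) * s) * h'

lemma continuous_u : Continuous u := by
  refine Continuous.subtype_mk (Continuous.subtype_mk ?_ _) _
  refine continuous_matrix fun i j => ?_
  fin_cases i <;> fin_cases j <;> simp <;> fun_prop

variable {X : Type*} [MulAction B X]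

lemma u_add_smul (s r : ℝ) (x : X) : u (s + r) • x = u s • u r • x := by
  rw [u_add, mul_smul]

lemma u_smul_u_neg_smul (s : ℝ) (x : X) : u s • u (-s) • x = x := by
  rw [← u_add_smul, add_neg_cancel, u_zero, one_smul]

lemma a_smul_u_smul (t s : ℝ) (x : X) : a t • u s • x = u (Real.exp t * s) • a t • x := by
  rw [← mul_smul, a_mul_u, mul_smul]

variable [TopologicalSpace X] [ContinuousSMul B X]

lemma continuous_u_smul : Continuous fun p : ℝ × X => u p.1 • p.2 :=
  (continuous_u.comp continuous_fst).smul continuous_snd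

/-- A compactly supported continuous function is uniformly continuous along the flow `u`. -/
lemma exists_modulus {g : X → ℝ} (hg : Continuous g) (hgc : HasCompactSupport g) {ε : ℝ}
    (hε : 0 < ε) : ∃ ρ > 0, ∀ (x : X) (r : ℝ), |r| ≤ ρ → |g (u r • x) - g x| ≤ ε := by
  set K : Set X := (fun p : ℝ × X => u p.1 • p.2) '' (Set.Icc (-1) 1 ×ˢ tsupport g) with hK
  have hKc : IsCompact K := (isCompact_Icc.prod hgc).image continuous_u_smul
  have h1 : ∀ᶠ r in 𝓝 (0 : ℝ), ∀ x ∈ K, |g (u r • x) - g x| < ε := by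
    refine hKc.eventually_forall_of_forall_eventually fun x _ => ?_
    have hc : Continuous fun p : ℝ × X => |g (u p.1 • p.2) - g p.2| :=
      ((hg.comp continuous_u_smul).sub (hg.comp continuous_snd)).abs
    refine (hc.tendsto (0, x)).eventually_lt_const ?_
    simpa [u_zero] using hε
  obtain ⟨ρ, hρ, hball⟩ := Metric.eventually_nhds_iff.1 h1
  -- The bound `1` ensures that outside the thickened support `K` both values of `g` vanish; halving
  -- `ρ` gives the strict inequality for the ball.
  refine ⟨min (ρ / 2) 1, by positivity, fun x r hr => ?_⟩
  have hr1 : |r| ≤ 1 := hr.trans (min_le_right _ _)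
  have hr2 : |r| < ρ := by linarith [hr.trans (min_le_left _ _)]
  by_cases hx : x ∈ K
  · exact (hball (by simpa using hr2) x hx).le
  · have h2 : ∀ r' : ℝ, |r'| ≤ 1 → g (u r' • x) = 0 := by
      intro r' hr'
      by_contra hne
      refine hx ⟨(-r', u r' • x), ⟨?_, subset_tsupport g hne⟩, ?_⟩
      · rw [abs_le] at hr'
        exact ⟨by linarith, by linarith⟩
      · have := u_smul_u_neg_smul (-r') x
        rwa [neg_neg] at this
    have h3 := h2 0 (by simp)
    rw [u_zero, one_smul] at h3
    rw [h2 r hr1, h3]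
    simpa using hε.le

end Action

/-! ### The invariance defect and its limit -/

section Invariance

open ProbabilityTheory Finset

variable {X : Type*} [TopologicalSpace X] [MeasurableSpace X] [BorelSpace X]
   [MulAction B X] [ContinuousSMul B X]

lemma measurable_u_neg_smul : Measurable fun p : X × ℝ => u (-p.2) • p.1 := by
  have h : Continuous fun p : X × ℝ => u (-p.2) • p.1 :=
    (continuous_u.comp continuous_snd.neg).smul continuous_fst
  exact h.measurable

lemma measurable_u_smul : Measurable fun p : X × ℝ => u p.2 • p.1 := by
  have h : Continuous fun p : X × ℝ => u p.2 • p.1 :=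
    (continuous_u.comp continuous_snd).smul continuous_fst
  exact h.measurable

/-- The two translations cancel. Combined with the disintegration, this writes `μ` as a mixture of
measures carried by `u`-orbits. -/
lemma map_jointLaw (μ : Measure X) [IsProbabilityMeasure μ] :
    (jointLaw (fun s x => u s • x) μ).map (fun p => u p.2 • p.1) = μ := by
  rw [jointLaw, Measure.map_map measurable_u_smul (measurable_skew
    (φ := fun s (x : X) => u s • x) measurable_u_neg_smul)]
  simp only [Function.comp_def, u_smul_u_neg_smul]
  change (μ.prod _).map Prod.fst = μ
  simp

/-- The defect of `u s₀`-invariance of an `a`-invariant measure of `u`-leafwise dimension `δ`,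
tested on `g`, in terms of `log n - b` for any `b < δ log n`. -/
lemma abs_integral_sub_integral_u_smul_le {μ : Measure X} [IsProbabilityMeasure μ]
    (hinv : IsAInvariant μ) {δ : ℝ} (hdim : HasLeafwiseDim μ δ) {g : X → ℝ} (hg : Continuous g)
    {M : ℝ} (hM : ∀ x, |g x| ≤ M) {s₀ : ℝ} (hs₀ : 0 < s₀) {m L : ℕ} (hm : 2 ≤ m) (hL : 0 < L)
    {ε : ℝ} (hε : ∀ (x : X) (r : ℝ), |r| ≤ s₀ / L → |g (u r • x) - g x| ≤ ε)
    {η : ℝ} (hη : 0 < η) {b : ℝ} (hb : 0 ≤ b) (hbδ : b < δ * Real.log (m * L : ℕ)) :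
    |∫ x, g x ∂μ - ∫ x, g (u s₀ • x) ∂μ| ≤ 2 * ε + 2 * M * (1 / m) +
      2 * M * (η + ((m * L : ℕ) + 1) / (2 * η) * (Real.log (m * L : ℕ) - b)) := by
  obtain ⟨ν, hν, hνδ⟩ := hdim
  obtain ⟨κ, hκ, hκ1, hQ, hκν⟩ := exists_unit_kernel measurable_u_neg_smul hν
  set n : ℕ := m * L with hn
  have hn2 : 2 ≤ n := hm.trans (Nat.le_mul_of_pos_right m hL)
  have hn0 : 0 < n := by omega
  have hn' : (0 : ℝ) < n := by exact_mod_cast hn0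
  have hm' : (0 : ℝ) < m := by exact_mod_cast (by omega : 0 < m)
  have hL' : (0 : ℝ) < L := by exact_mod_cast hL
  obtain ⟨N, hN, hNb⟩ := exists_le_integral_cellEntropy measurable_u_neg_smul hQ
    hν.locallyFinite hκν hνδ hn2 hb hbδ
  have hprobQ := isProbabilityMeasure_jointLaw (μ := μ) (φ := fun s x => u s • x)
    measurable_u_neg_smul
  set Q := jointLaw (fun s x => u s • x) μ with hQdef
  set D := ∫ x, g x ∂μ - ∫ x, g (u s₀ • x) ∂μ with hD
  set K : ℝ := ((n : ℝ) + 1) / (2 * η) with hKdef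
  have hgb : ∀ x, |g x - g (u s₀ • x)| ≤ 2 * M := fun x => by
    have := abs_sub (g x) (g (u s₀ • x))
    linarith [hM x, hM (u s₀ • x)]
  have hus : Continuous fun x : X => u s₀ • x := continuous_const_smul _
  have hdc : Continuous fun x => g x - g (u s₀ • x) := hg.sub (hg.comp hus)
  have hDi : D = ∫ x, (g x - g (u s₀ • x)) ∂μ := by
    rw [hD, integral_sub]
    · exact Integrable.of_bound hg.aestronglyMeasurable (C := M) (ae_of_all _ hM)
    · exact Integrable.of_bound (hg.comp hus).aestronglyMeasurable (C := M)
        (ae_of_all _ fun x => hM _)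
  -- By `a`-invariance the same `D` is bounded by the entropy defect at every level `i`.
  have hstep : ∀ i : ℕ, |D| ≤ 2 * ε + 2 * M * (1 / m) + 2 * M * (η + K * (Real.log n -
      (∫ y, cellEntropy n (κ y) (i + 1) ∂Q.fst - ∫ y, cellEntropy n (κ y) i ∂Q.fst))) := by
    intro i
    -- With `n = m * L`, a shift by `L / n = 1 / m` becomes the translation by `s₀`, and one child
    -- cell `1 / n` becomes the orbit length `s₀ / L` at which `hε` applies.
    set β : ℝ := s₀ * m with hβ
    have hβ0 : 0 < β := by positivity
    set t : ℝ := Real.log (β * (n : ℝ) ^ i) with ht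
    have hexp : Real.exp t = β * (n : ℝ) ^ i := Real.exp_log (by positivity)
    have hat : Continuous fun x : X => a t • x := continuous_const_smul _
    have hF : Measurable fun p : X × ℝ =>
        g (a t • u p.2 • p.1) - g (u s₀ • a t • u p.2 • p.1) :=
      (hdc.comp hat).measurable.comp measurable_u_smul
    have h1 : D = ∫ p, (g (a t • u p.2 • p.1) - g (u s₀ • a t • u p.2 • p.1)) ∂Q := by
      rw [hDi]
      conv_lhs => rw [← hinv t]
      rw [integral_map hat.aemeasurable hdc.aestronglyMeasurable]
      conv_lhs => rw [← map_jointLaw μ]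
      rw [integral_map (f := fun x => g (a t • x) - g (u s₀ • a t • x))
        measurable_u_smul.aemeasurable (hdc.comp hat).aestronglyMeasurable]
    have h2 : Integrable (fun p : X × ℝ =>
        g (a t • u p.2 • p.1) - g (u s₀ • a t • u p.2 • p.1)) (Q.fst ⊗ₘ κ) :=
      Integrable.of_bound hF.aestronglyMeasurable (C := 2 * M) (ae_of_all _ fun p => hgb _)
    rw [h1, hQ, Measure.integral_compProd h2]
    have hfst : (Q.fst ⊗ₘ κ).fst = Q.fst := by rw [← hQ]
    rw [hfst]
    have h3 : ∀ y, |∫ s, (g (a t • u s • y) - g (u s₀ • a t • u s • y)) ∂(κ y)| ≤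
        2 * ε + 2 * M * (1 / m) + 2 * M * (η + K * (Real.log n -
          (cellEntropy n (κ y) (i + 1) - cellEntropy n (κ y) i))) := by
      intro y
      have hk : Continuous fun r : ℝ => g (u (β * r) • a t • y) :=
        hg.comp ((continuous_u.comp (continuous_const.mul continuous_id)).smul continuous_const)
      have h4 := abs_integral_sub_shift_le (L := L) hn0 (hκ1 y) i hk.measurable
        (M := M) (ε := ε) (fun r => hM _) (fun r r' hrr => by
          have h5 : β * r' = β * (r' - r) + β * r := by ring
          rw [h5, u_add_smul]
          refine hε _ _ ?_
          rw [abs_mul, abs_of_pos hβ0]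
          refine (mul_le_mul_of_nonneg_left hrr hβ0.le).trans_eq ?_
          rw [hn, hβ]; push_cast; field_simp) hη
      have h6 : (L : ℝ) / n = 1 / m := by rw [hn]; push_cast; field_simp
      rw [h6] at h4
      refine le_trans (le_of_eq ?_) h4
      congr 1
      refine integral_congr_ae (ae_of_all _ fun s => ?_)
      have h7 : β * ((n : ℝ) ^ i * s + 1 / m) = s₀ + Real.exp t * s := by
        rw [hexp, hβ]; field_simp; ring
      have h8 : β * ((n : ℝ) ^ i * s) = Real.exp t * s := by rw [hexp]; ring
      simp only
      rw [h7, h8, u_add_smul, a_smul_u_smul]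
    have hi1 := integrable_cellEntropy Q.fst κ n (i + 1)
    have hi0 := integrable_cellEntropy Q.fst κ n i
    refine (abs_integral_le_integral_abs).trans ?_
    refine (integral_mono_of_nonneg (ae_of_all _ fun y => abs_nonneg _) ?_
      (ae_of_all _ h3)).trans_eq ?_
    · fun_prop
    · set c₀ := 2 * ε + 2 * M * (1 / m) + 2 * M * (η + K * Real.log n) with hc₀
      set c₁ := 2 * M * K with hc₁
      have h9 : ∀ y, 2 * ε + 2 * M * (1 / m) + 2 * M * (η + K * (Real.log n -
          (cellEntropy n (κ y) (i + 1) - cellEntropy n (κ y) i))) =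
          c₀ - c₁ * cellEntropy n (κ y) (i + 1) + c₁ * cellEntropy n (κ y) i := fun y => by
        rw [hc₀, hc₁]; ring
      simp_rw [h9]
      rw [integral_add (by fun_prop) (by fun_prop), integral_sub (by fun_prop) (by fun_prop),
        integral_const_mul, integral_const_mul, integral_const, probReal_univ, one_smul, hc₀, hc₁]
      ring
  have hN' : (0 : ℝ) < N := by exact_mod_cast hN
  have hM0 : 0 ≤ M := by
    obtain ⟨x⟩ : Nonempty X := nonempty_of_isProbabilityMeasure μ
    exact (abs_nonneg _).trans (hM x)
  have hK0 : 0 ≤ K := by positivity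
  -- Summing over levels telescopes the gains, starting from zero entropy at level `0`.
  have hsum := sum_le_sum fun i (_ : i ∈ range N) => hstep i
  have hE0 : ∫ y, cellEntropy n (κ y) 0 ∂Q.fst = 0 := by
    simp [cellEntropy_zero n (hκ1 _)]
  simp only [sum_add_distrib, ← mul_sum, sum_const, card_range, nsmul_eq_mul, sum_sub_distrib,
    sum_range_sub (fun i => ∫ y, cellEntropy n (κ y) i ∂Q.fst), hE0, sub_zero] at hsum
  have hfin : 2 * M * (K * (N * b)) ≤ 2 * M * (K * ∫ y, cellEntropy n (κ y) N ∂Q.fst) := by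
    gcongr
  refine le_of_mul_le_mul_left ?_ hN'
  nlinarith [hsum, hfin]

/-- Integrals over the limit measure of compactly supported functions are invariant under `u`. -/
lemma integral_eq_integral_u_smul_of_tendsto {μ : ℕ → Measure X}
    (hprob : ∀ k, IsProbabilityMeasure (μ k))
    (hinv : ∀ k, IsAInvariant (μ k)) {δ : ℕ → ℝ} (hdim : ∀ k, HasLeafwiseDim (μ k) (δ k))
    (hδ : Tendsto δ atTop (𝓝 1)) {μ' : Measure X} (hlim : WeakStarTendsto μ μ')
    {g : X → ℝ} (hg : Continuous g) (hgc : HasCompactSupport g) {s₀ : ℝ} (hs₀ : 0 < s₀) :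
    ∫ x, g x ∂μ' = ∫ x, g (u s₀ • x) ∂μ' := by
  obtain ⟨M, hM⟩ := hgc.exists_bound_of_continuous hg
  replace hM : ∀ x, |g x| ≤ |M| := fun x => (hM x).trans (le_abs_self M)
  have hM0 := abs_nonneg M
  set A := |M| with hA
  have hl1 := hlim g hg hgc
  have hl2 : Tendsto (fun k => ∫ x, g (u s₀ • x) ∂(μ k)) atTop (𝓝 (∫ x, g (u s₀ • x) ∂μ')) :=
    hlim _ (hg.comp (continuous_const_smul _)) (hgc.comp_homeomorph (Homeomorph.smul (u s₀)))
  rw [← sub_eq_zero, ← abs_nonpos_iff]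
  refine le_of_forall_pos_le_add fun θ hθ => ?_
  rw [zero_add]
  obtain ⟨ρ, hρ, hmod⟩ := exists_modulus hg hgc (by positivity : 0 < θ / 8)
  obtain ⟨L, hL⟩ := exists_nat_gt (s₀ / ρ)
  have hL' : (0 : ℝ) < L := (by positivity : 0 < s₀ / ρ).trans hL
  have hL0 : 0 < L := by exact_mod_cast hL'
  have hLρ : s₀ / L ≤ ρ := by
    rw [div_lt_iff₀ hρ] at hL
    rw [div_le_iff₀ hL']
    linarith
  -- The tolerance `θ` splits into four quarters: `2 * ε` with `ε = θ / 8`, and three terms at most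
  -- `2 * A * τ`, from the boundary (`1 / m`), from `η = τ` and from the entropy defect.
  set τ : ℝ := θ / (8 * (A + 1)) with hτ
  have hτ0 : 0 < τ := by positivity
  have hAτ : 2 * A * τ ≤ θ / 4 := by
    have : 8 * (A + 1) * τ = θ := by rw [hτ]; field_simp
    nlinarith
  obtain ⟨m, hm⟩ := exists_nat_gt (max 2 (1 / τ))
  have hm2 : 2 ≤ m := by exact_mod_cast ((le_max_left _ _).trans hm.le)
  have hm' : (0 : ℝ) < m := by exact_mod_cast (by omega : 0 < m)
  have hmτ : 1 / (m : ℝ) ≤ τ := by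
    rw [div_le_iff₀ hm', mul_comm, ← div_le_iff₀ hτ0]
    exact (le_max_right _ _).trans hm.le
  have hn2 : 1 < m * L := lt_of_lt_of_le (by omega : 1 < m) (Nat.le_mul_of_pos_right m hL0)
  have hlog : 0 < Real.log (m * L : ℕ) := Real.log_pos (by exact_mod_cast hn2)
  set K : ℝ := ((m * L : ℕ) + 1) / (2 * τ) with hK
  have hK0 : 0 < K := by positivity
  -- All of `m`, `L`, `K` and `b` are fixed before `k`, so `δ k → 1` alone gives `b < δ k * log n`
  -- eventually.
  set b : ℝ := max 0 (Real.log (m * L : ℕ) - τ / K) with hb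
  have hbl : b < 1 * Real.log (m * L : ℕ) := by
    rw [one_mul]
    exact max_lt hlog (sub_lt_self _ (by positivity))
  have hbK : K * (Real.log (m * L : ℕ) - b) ≤ τ := by
    have h1 : Real.log (m * L : ℕ) - b ≤ τ / K := by
      linarith [le_max_right 0 (Real.log (m * L : ℕ) - τ / K)]
    rw [le_div_iff₀ hK0] at h1
    linarith
  have hev : ∀ᶠ k in atTop, |∫ x, g x ∂(μ k) - ∫ x, g (u s₀ • x) ∂(μ k)| ≤ θ := by
    filter_upwards [(hδ.mul_const (Real.log (m * L : ℕ))).eventually_const_lt hbl] with k hk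
    have := hprob k
    refine (abs_integral_sub_integral_u_smul_le (hinv k) (hdim k) hg hM hs₀ hm2 hL0
      (fun x r hr => hmod x r (hr.trans hLρ)) hτ0 (le_max_left _ _) hk).trans ?_
    have h1 : 2 * A * (1 / m) ≤ 2 * A * τ := by gcongr
    have h2 : 2 * A * (K * (Real.log (m * L : ℕ) - b)) ≤ 2 * A * τ := by gcongr
    rw [mul_add (2 * A)]
    linarith
  exact le_of_tendsto (hl1.sub hl2).abs hev

end Invariance

end

end LeafwiseDim

theorem theorem3p5 {X : Type*} [TopologicalSpace X] [T2Space X] [LocallyCompactSpace X]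
    [SecondCountableTopology X] [MeasurableSpace X] [BorelSpace X]
    [MulAction LeafwiseDim.B X] [ContinuousSMul LeafwiseDim.B X]
    (μ : ℕ → Measure X) (hprob : ∀ k, IsProbabilityMeasure (μ k))
    (hinv : ∀ k, LeafwiseDim.IsAInvariant (μ k))
    (herg : ∀ k, LeafwiseDim.IsAErgodic (μ k))
    (hfree : ∀ k, LeafwiseDim.IsUFree (μ k))
    (δ : ℕ → ℝ) (hdim : ∀ k, LeafwiseDim.HasLeafwiseDim (μ k) (δ k))
    (hδ : Tendsto δ atTop (𝓝 1))
    (μ' : Measure X) (hprob' : IsProbabilityMeasure μ')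
    (hlim : LeafwiseDim.WeakStarTendsto μ μ') :
    LeafwiseDim.IsUInvariant μ' := by
  have hcont : ∀ s : ℝ, Continuous fun x : X => LeafwiseDim.u s • x :=
    fun s => continuous_const_smul _
  have hpos : ∀ s : ℝ, 0 < s → μ'.map (fun x => LeafwiseDim.u s • x) = μ' := by
    intro s hs
    have := Measure.isProbabilityMeasure_map (μ := μ') (hcont s).aemeasurable
    refine Measure.ext_of_integral_eq_on_compactlySupported fun f => ?_
    rw [integral_map (f := fun x => f x) (hcont s).aemeasurable f.continuous.aestronglyMeasurable]
    exact (LeafwiseDim.integral_eq_integral_u_smul_of_tendsto hprob hinv hdim hδ hlim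
      f.continuous f.hasCompactSupport hs).symm
  intro s
  rcases lt_trichotomy s 0 with hs | rfl | hs
  -- For negative `s`, write `μ'` as its own image under the inverse translation, which is already
  -- covered.
  · conv_lhs => rw [← hpos (-s) (by linarith)]
    rw [Measure.map_map (hcont s).measurable (hcont (-s)).measurable]
    simp only [Function.comp_def, LeafwiseDim.u_smul_u_neg_smul]
    exact Measure.map_id
  · simp only [LeafwiseDim.u_zero, one_smul]
    exact Measure.map_id
  · exact hpos s hs
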